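/- **Theorem 3.** Consider the two-player differentiable game $\mathcal N$ in which player 1 has parameter $x\in\mathbb R$, player 2 has parameter $y\in\mathbb R$, and, with $\theta=(x,y)$, the losses are $$L^1(x,y)=xy-\tfrac{x^2}{2}+\tfrac{y^2}{2}+\tfrac{x^4}{4}-\tfrac{y^4}{4}=-L^2(x,y).$$ Write $\xi=(\partial_xL^1,\partial_yL^2)^{T}$ for the simultaneous gradient, $H=\nabla\xi$ for its (in general non-symmetric) Jacobian, $A=\frac12(H-H^T)$ for the antisymmetric part and $H_o$ for the off-diagonal part of $H$, and $\chi=\operatorname{diag}(H_o^T\nabla L)$, where $\nabla L$ is the matrix with columns $\nabla L^1,\nabla L^2$. A critical point is a zero of $\xi$; it is a strict maximum if $u^TH u<0$ there for all $u\neq0$. (a) $\mathcal N$ is zero-sum; analytic; weakly coercive, i.e. $L^1(x,y)\to\infty$ as $|x|\to\infty$ for every fixed $y$ and $L^2(x,y)\to\infty$ as $|y|\to\infty$ for every fixed $x$; and nondegenerate, i.e. $H$ is invertible at every critical point. It has exactly one critical point, and this is a strict maximum. (b) Let $\mathcal A$ consist of the algorithms $\theta_{k+1}=\theta_k-\alpha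 G(\theta_k)$ with learning rate $\alpha>0$ and $G$ one of - GD: $\xi$; - AGD: $\big(\xi_1(x,y),\ \xi_2(x-\alpha\xi_1(x,y),\,y)\big)$; - EG: $\xi\circ(\mathrm{id}-\alpha\xi)$; - OMD: $2\xi(\theta_k)-\xi(\theta_{k-1})$ with $\theta_{-1}=\theta_0$, and also its memoryless form $2\xi-\xi\circ(\mathrm{id}-\alpha\xi)^{-1}$, where $(\mathrm{id}-\alpha\xi)^{-1}(\theta)$ is the limit of the proximal point iteration $\eta\mapsto\theta+\alpha\xi(\eta)$ started at $\theta$; - SGA: $(I+\lambda A^T)\xi$ with $\lambda=\operatorname{sign}\big(\langle\xi,H^T\xi\rangle\,\langle A^T\xi,H^T\xi\rangle\big)$, $\operatorname{sign}(0)=0$; - CO: $(I+\gamma H^T)\xi$, with a hyperparameter $\gamma>0$; - CGD: $(I+\alpha H_o)^{-1}\xi$; - LA: $(I-\alpha H_o)\xi$; - LOLA: $(I-\alpha H_o)\xi-\alpha\chi$; - SOS: $(I-\alpha H_o)\xi-p\,\alpha\,\chi$, where $p=p(\theta)$ is any function with values in $[0,1]$ (in particular the usual two-part criterion of SOS, which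 may depend on $\alpha$). For every bounded set $U\subset\mathbb R^2$ there is $\delta>0$ such that for all $\alpha,\gamma\in(0,\delta)$, every algorithm in $\mathcal A$ and every continuous (atomless; for example absolutely continuous) probability measure $\nu$ concentrated on $U$, the following holds for $\nu$-almost every initial point $\theta_0$: the iterates $(\theta_k)$ are well defined (the inverses that occur exist at every iterate), bounded, and not convergent. -/

import Mathlib

open Filter Topology MeasureTheory Matrix

noncomputable section

/-- A two-player differentiable game. The joint parameter vector lives in `κ → ℝ`, each coordinate
belongs to the player `owner k`, and `loss i` is the loss of player `i` (players are `0` and `1`).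
All notions below that involve size (boundedness, convergence, tending to infinity) do not depend
on the choice of a norm on `κ → ℝ`; inner products are written with `⬝ᵥ`. -/
structure TwoPlayerGame (κ : Type) [Fintype κ] [DecidableEq κ] where
  owner : κ → Fin 2
  loss : Fin 2 → (κ → ℝ) → ℝ
  contDiff_loss : ∀ i, ContDiff ℝ 2 (loss i)

namespace TwoPlayerGame

variable {κ : Type} [Fintype κ] [DecidableEq κ]

/-- The partial derivative of `f` in the coordinate `k`. -/
def pd (f : (κ → ℝ) → ℝ) (k : κ) (θ : κ → ℝ) : ℝ := fderiv ℝ f θ (Pi.single k 1)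

/-- The simultaneous gradient `ξ`: each player's gradient of that player's own loss. -/
def xi (G : TwoPlayerGame κ) (θ : κ → ℝ) : κ → ℝ := fun k => pd (G.loss (G.owner k)) k θ

/-- The game Hessian `H = ∇ξ`, with entries `∂_l ∂_k L^{owner k}`. -/
def hess (G : TwoPlayerGame κ) (θ : κ → ℝ) : Matrix κ κ ℝ :=
  Matrix.of fun k l => pd (pd (G.loss (G.owner k)) k) l θ

/-- The off-diagonal blocks `H_o` of the Hessian. -/
def hessOff (G : TwoPlayerGame κ) (θ : κ → ℝ) : Matrix κ κ ℝ :=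
  Matrix.of fun k l => if G.owner k = G.owner l then 0 else G.hess θ k l

/-- The antisymmetric part `A` of the Hessian. -/
def hessAnti (G : TwoPlayerGame κ) (θ : κ → ℝ) : Matrix κ κ ℝ :=
  (1 / 2 : ℝ) • (G.hess θ - (G.hess θ)ᵀ)

/-- The vector `diag (H_oᵀ ∇L)`, where `∇L` has the gradient of `L^i` as its `i`-th column; the
block of player `i` is read off the `i`-th column. -/
def chi (G : TwoPlayerGame κ) (θ : κ → ℝ) : κ → ℝ :=
  fun k => ∑ l, G.hessOff θ l k * pd (G.loss (G.owner k)) l θ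

/-- Critical points. -/
def IsCritical (G : TwoPlayerGame κ) (θ : κ → ℝ) : Prop := G.xi θ = 0

/-- Strict maxima: critical points whose (not necessarily symmetric) Hessian is negative
definite. -/
def IsStrictMax (G : TwoPlayerGame κ) (θ : κ → ℝ) : Prop :=
  G.IsCritical θ ∧ ∀ u : κ → ℝ, u ≠ 0 → u ⬝ᵥ (G.hess θ *ᵥ u) < 0

/-- The Hessian is invertible at every critical point. -/
def Nondegenerate (G : TwoPlayerGame κ) : Prop :=
  ∀ θ, G.IsCritical θ → IsUnit (G.hess θ)

def ZeroSum (G : TwoPlayerGame κ) : Prop := ∀ θ, G.loss 0 θ + G.loss 1 θ = 0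

def Analytic (G : TwoPlayerGame κ) : Prop := ∀ i, AnalyticOnNhd ℝ (G.loss i) Set.univ

/-- Each player's loss tends to infinity when that player's parameters tend to infinity while the
parameters of the other player stay fixed. -/
def WeaklyCoercive (G : TwoPlayerGame κ) : Prop :=
  ∀ (i : Fin 2) (θ : κ → ℝ),
    Tendsto (G.loss i) (cocompact (κ → ℝ) ⊓ 𝓟 {η | ∀ k, G.owner k ≠ i → η k = θ k}) atTop

/-- The proximal point iteration `η ↦ θ + α ξ(η)`, started at `θ`. -/
def prox (G : TwoPlayerGame κ) (α : ℝ) (θ : κ → ℝ) (m : ℕ) : κ → ℝ :=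
  (fun η => θ + α • G.xi η)^[m] θ

/-- `(id - α ξ)⁻¹ θ`, computed as the limit of the proximal point iteration. -/
def proxInv (G : TwoPlayerGame κ) (α : ℝ) (θ : κ → ℝ) : κ → ℝ :=
  limUnder atTop (G.prox α θ)

end TwoPlayerGame

/-- The algorithms. `omd` is optimistic mirror descent with its memory of the previous iterate,
`omdProx` is its memoryless form. `sos` comes with an arbitrary weight function `p`
with values in `[0, 1]`; see `Algorithm.sosTwoPart` for the usual one. -/
inductive Algorithm (κ : Type) : Type
  | gd | agd | eg | omd | omdProx | sga | co | cgd | la | lola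
  | sos (p : (κ → ℝ) → ℝ) (hp : ∀ θ, p θ ∈ Set.Icc (0 : ℝ) 1)

namespace Algorithm

variable {κ : Type} [Fintype κ] [DecidableEq κ]

/-- The update direction: the next iterate is `cur - α • direction prev cur`. Only `omd` makes use
of the previous iterate `prev`, and only `co` of the hyperparameter `γ`. -/
def direction (G : TwoPlayerGame κ) (α γ : ℝ) :
    Algorithm κ → (κ → ℝ) → (κ → ℝ) → (κ → ℝ)
  | gd, _, θ => G.xi θ
  | agd, _, θ => fun k =>
      if G.owner k = 0 then G.xi θ k
      else G.xi (fun l => if G.owner l = 0 then θ l - α * G.xi θ l else θ l) k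
  | eg, _, θ => G.xi (θ - α • G.xi θ)
  | omd, prev, θ => (2 : ℝ) • G.xi θ - G.xi prev
  | omdProx, _, θ => (2 : ℝ) • G.xi θ - G.xi (G.proxInv α θ)
  | sga, _, θ =>
      (1 + Real.sign ((G.xi θ ⬝ᵥ ((G.hess θ)ᵀ *ᵥ G.xi θ)) *
          (((G.hessAnti θ)ᵀ *ᵥ G.xi θ) ⬝ᵥ ((G.hess θ)ᵀ *ᵥ G.xi θ))) •
        (G.hessAnti θ)ᵀ) *ᵥ G.xi θ
  | co, _, θ => (1 + γ • (G.hess θ)ᵀ) *ᵥ G.xi θ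
  | cgd, _, θ => (1 + α • G.hessOff θ)⁻¹ *ᵥ G.xi θ
  | la, _, θ => (1 - α • G.hessOff θ) *ᵥ G.xi θ
  | lola, _, θ => (1 - α • G.hessOff θ) *ᵥ G.xi θ - α • G.chi θ
  | sos p _, _, θ => (1 - α • G.hessOff θ) *ᵥ G.xi θ - (p θ * α) • G.chi θ

/-- The inverses that occur in the update direction at `θ` exist: for `cgd` the matrix
`I + α H_o` is invertible, for `omdProx` the proximal point iteration converges (and then, as `ξ`
is continuous, to a solution `η` of `η - α ξ(η) = θ`). -/
def StepDefined (G : TwoPlayerGame κ) (α : ℝ) : Algorithm κ → (κ → ℝ) → Prop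
  | omdProx, θ => ∃ η, Tendsto (G.prox α θ) atTop (𝓝 η)
  | cgd, θ => IsUnit (1 + α • G.hessOff θ)
  | _, _ => True

/-- The iterates from `θ₀`; the iterate before `θ₀`, needed by `omd` only, is `θ₀` itself. -/
def iterates (G : TwoPlayerGame κ) (α γ : ℝ) (F : Algorithm κ) (θ₀ : κ → ℝ) : ℕ → (κ → ℝ)
  | 0 => θ₀
  | 1 => θ₀ - α • F.direction G α γ θ₀ θ₀
  | k + 2 => iterates G α γ F θ₀ (k + 1) -
      α • F.direction G α γ (iterates G α γ F θ₀ k) (iterates G α γ F θ₀ (k + 1))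

/-- The usual two-part weight of `sos`, with hyperparameters `a, b` (in `(0, 1)`). -/
def sosWeight (G : TwoPlayerGame κ) (α a b : ℝ) (θ : κ → ℝ) : ℝ :=
  let ξ₀ := (1 - α • G.hessOff θ) *ᵥ G.xi θ
  let t := ((-α) • G.chi θ) ⬝ᵥ ξ₀
  min (if 0 ≤ t then 1 else min 1 (-a * (ξ₀ ⬝ᵥ ξ₀) / t))
    (if G.xi θ ⬝ᵥ G.xi θ < b ^ 2 then G.xi θ ⬝ᵥ G.xi θ else 1)

theorem sosWeight_mem (G : TwoPlayerGame κ) (α a b : ℝ) (ha : a ∈ Set.Ioo (0 : ℝ) 1)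
    (θ : κ → ℝ) : sosWeight G α a b θ ∈ Set.Icc (0 : ℝ) 1 := by
  have nn : ∀ v : κ → ℝ, 0 ≤ v ⬝ᵥ v := fun v =>
    Finset.sum_nonneg fun i _ => mul_self_nonneg (v i)
  refine ⟨le_min ?_ ?_, (min_le_left _ _).trans ?_⟩
  · split_ifs with h
    · exact zero_le_one
    · refine le_min zero_le_one (div_nonneg_of_nonpos ?_ (not_le.mp h).le)
      have := mul_nonneg ha.1.le (nn ((1 - α • G.hessOff θ) *ᵥ G.xi θ))
      linarith
  · split_ifs
    · exact nn _
    · exact zero_le_one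
  · split_ifs
    · exact le_rfl
    · exact min_le_left _ _

/-- Stable opponent shaping with the usual two-part weight. -/
def sosTwoPart (G : TwoPlayerGame κ) (α a b : ℝ) (ha : a ∈ Set.Ioo (0 : ℝ) 1) :
    Algorithm κ :=
  sos (sosWeight G α a b) (sosWeight_mem G α a b ha)

end Algorithm

/-- The zero-sum game `L¹ = xy - x²/2 + y²/2 + x⁴/4 - y⁴/4 = -L²`, with `x = θ 0` the parameter of
the first player and `y = θ 1` the parameter of the second. -/
def gameN : TwoPlayerGame (Fin 2) where
  owner := id
  loss := ![
    fun θ => θ 0 * θ 1 - θ 0 ^ 2 / 2 + θ 1 ^ 2 / 2 + θ 0 ^ 4 / 4 - θ 1 ^ 4 / 4,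
    fun θ => -(θ 0 * θ 1 - θ 0 ^ 2 / 2 + θ 1 ^ 2 / 2 + θ 0 ^ 4 / 4 - θ 1 ^ 4 / 4)]
  contDiff_loss := by
    intro i
    fin_cases i <;> simp <;> fun_prop

end

/-!
Every algorithm moves against a direction of the form `(I + l Aᵀ) ξ` up to a small relative error,
with `|l| ≤ 1` and, near the origin, `l ≤ 0`. Since `⟨θ, ξ⟩ = x⁴ + y⁴ - |θ|²`, and since the
rotational part `l ⟨θ, Aᵀ ξ⟩` has a favourable sign near the origin and is at most
`|θ|² + |θ|⁴ / 4` in absolute value, a step increases `|θ|` near the origin and decreases it far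
away, as soon as the rates are small. So a large disc traps the iterates, and they never reach the
origin. If they converged, the displacements, and with them `ξ`, would tend to `0`; the limit would
be the only critical point, the origin, which repels.
-/

theorem norm_pow_sub_pow_le {R : Type*} [SeminormedCommRing R] [NormOneClass R] {a b : R} {s : ℝ}
    (ha : ‖a‖ ≤ s) (hb : ‖b‖ ≤ s) (n : ℕ) :
    ‖a ^ n - b ^ n‖ ≤ n * s ^ (n - 1) * ‖a - b‖ := by
  have hs : 0 ≤ s := (norm_nonneg a).trans ha
  have hterm : ∀ i ∈ Finset.range n, ‖a ^ i * b ^ (n - 1 - i)‖ ≤ s ^ (n - 1) := fun i hi =>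
    calc ‖a ^ i * b ^ (n - 1 - i)‖ ≤ ‖a‖ ^ i * ‖b‖ ^ (n - 1 - i) :=
          norm_mul_le_of_le (norm_pow_le a i) (norm_pow_le b _)
      _ ≤ s ^ i * s ^ (n - 1 - i) := by gcongr
      _ = s ^ (n - 1) := by
          rw [← pow_add, Nat.add_sub_cancel' (Nat.le_sub_one_of_lt (Finset.mem_range.1 hi))]
  rw [← geom_sum₂_mul]
  refine norm_mul_le_of_le ((norm_sum_le_of_le _ hterm).trans_eq ?_) le_rfl
  rw [Finset.sum_const, Finset.card_range, nsmul_eq_mul]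

theorem tendsto_zero_of_tendsto_of_sub_smul {E : Type*} [NormedAddCommGroup E] [NormedSpace ℝ E]
    {α : ℝ} (hα : α ≠ 0) {z d : ℕ → E} (hz : ∀ k, z (k + 1) = z k - α • d k) {c : E}
    (hc : Tendsto z atTop (𝓝 c)) : Tendsto d atTop (𝓝 0) := by
  have hd (k : ℕ) : α⁻¹ • (z k - z (k + 1)) = d k := by
    rw [hz, sub_sub_cancel, inv_smul_smul₀ hα]
  simpa only [Function.comp_apply, hd, sub_self, smul_zero] using
    (hc.sub (hc.comp (tendsto_add_atTop_nat 1))).const_smul α⁻¹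

theorem not_tendsto_zero_of_le_succ {r : ℕ → ℝ} {ε : ℝ} (hε : 0 < ε) (hpos : ∀ k, 0 < r k)
    (hr : ∀ k, r k ≤ ε → r k ≤ r (k + 1)) : ¬ Tendsto r atTop (𝓝 0) := by
  intro h
  obtain ⟨N, hN⟩ := eventually_atTop.1 (h.eventually_le_const hε)
  have hmono : Monotone fun m => r (m + N) :=
    monotone_nat_of_le_succ fun m => by
      simpa only [Nat.add_right_comm] using hr (m + N) (hN _ (Nat.le_add_left N m))
  exact ((hpos _).trans_le (hmono.ge_of_tendsto (h.comp (tendsto_add_atTop_nat N)) 0)).false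

theorem tendsto_abs_apply_cocompact_inf_principal {κ : Type*} [Finite κ] (i : κ) (θ : κ → ℝ) :
    Tendsto (fun η : κ → ℝ => |η i|) (cocompact (κ → ℝ) ⊓ 𝓟 {η | ∀ k, k ≠ i → η k = θ k})
      atTop := by
  have := Fintype.ofFinite κ
  refine tendsto_atTop.2 fun b => ?_
  have hlarge : ∀ᶠ η in cocompact (κ → ℝ), max b ‖θ‖ < ‖η‖ :=
    tendsto_norm_cocompact_atTop.eventually_gt_atTop _
  filter_upwards [hlarge.filter_mono inf_le_left, mem_inf_of_right (mem_principal_self _)]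
    with η hη hθ
  by_contra! hb
  refine hη.not_ge ((pi_norm_le_iff_of_nonneg (le_max_of_le_right (norm_nonneg θ))).2 fun k => ?_)
  rcases eq_or_ne k i with rfl | hk
  · exact le_max_of_le_left hb.le
  · rw [hθ k hk]
    exact le_max_of_le_right (norm_le_pi_norm θ k)

theorem abs_sign_le_one (x : ℝ) : |Real.sign x| ≤ 1 := by
  rcases Real.sign_apply_eq x with h | h | h <;> simp [h]

theorem sign_nonpos {x : ℝ} (hx : x ≤ 0) : Real.sign x ≤ 0 := by
  rcases hx.lt_or_eq with h | rfl
  · exact (Real.sign_of_neg h).trans_le (by norm_num)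
  · exact Real.sign_zero.le

section dotProduct

variable {κ : Type*} [Fintype κ]

theorem dotProduct_self_nonneg (v : κ → ℝ) : 0 ≤ v ⬝ᵥ v := dotProduct_self_star_nonneg v

theorem continuous_dotProduct_self : Continuous fun v : κ → ℝ => v ⬝ᵥ v :=
  continuous_id.dotProduct continuous_id

theorem sq_dotProduct_le (v w : κ → ℝ) : (v ⬝ᵥ w) ^ 2 ≤ (v ⬝ᵥ v) * (w ⬝ᵥ w) := by
  simpa only [dotProduct, sq] using Finset.sum_mul_sq_le_sq_mul_sq Finset.univ v w

theorem abs_two_mul_dotProduct_le (v w : κ → ℝ) : |2 * (v ⬝ᵥ w)| ≤ v ⬝ᵥ v + w ⬝ᵥ w := by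
  have hsub := dotProduct_self_nonneg (v - w)
  have hadd := dotProduct_self_nonneg (v + w)
  simp only [sub_dotProduct, dotProduct_sub, add_dotProduct, dotProduct_add,
    dotProduct_comm w v] at hsub hadd
  exact abs_le.2 ⟨by linarith, by linarith⟩

theorem dotProduct_self_add_le (v w : κ → ℝ) :
    (v + w) ⬝ᵥ (v + w) ≤ 2 * (v ⬝ᵥ v + w ⬝ᵥ w) := by
  have h := (abs_le.1 (abs_two_mul_dotProduct_le v w)).2
  simp only [add_dotProduct, dotProduct_add, dotProduct_comm w v]
  linarith

theorem dotProduct_self_sub_smul (v w : κ → ℝ) (α : ℝ) :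
    (v - α • w) ⬝ᵥ (v - α • w) = v ⬝ᵥ v - 2 * α * (v ⬝ᵥ w) + α ^ 2 * (w ⬝ᵥ w) := by
  simp only [sub_dotProduct, dotProduct_sub, smul_dotProduct, dotProduct_smul, smul_eq_mul,
    dotProduct_comm w v]
  ring

theorem sq_norm_le_dotProduct_self (v : κ → ℝ) : ‖v‖ ^ 2 ≤ v ⬝ᵥ v := by
  refine (Real.le_sqrt (norm_nonneg v) (dotProduct_self_nonneg v)).1 ?_
  refine (pi_norm_le_iff_of_nonneg (Real.sqrt_nonneg _)).2 fun i => Real.abs_le_sqrt ?_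
  rw [sq]
  exact Finset.single_le_sum (f := fun j => v j * v j) (fun j _ => mul_self_nonneg (v j))
    (Finset.mem_univ i)

theorem norm_le_of_dotProduct_self_le_sq {v : κ → ℝ} {s : ℝ} (hs : 0 ≤ s) (h : v ⬝ᵥ v ≤ s ^ 2) :
    ‖v‖ ≤ s :=
  (sq_le_sq₀ (norm_nonneg v) hs).1 ((sq_norm_le_dotProduct_self v).trans h)

theorem dotProduct_self_le_card_mul_sq_norm (v : κ → ℝ) :
    v ⬝ᵥ v ≤ Fintype.card κ * ‖v‖ ^ 2 := by
  refine (Finset.sum_le_card_nsmul _ _ _ fun i _ => ?_).trans_eq (nsmul_eq_mul _ _)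
  rw [← abs_mul_abs_self, ← sq]
  gcongr
  exact norm_le_pi_norm v i

end dotProduct

theorem TwoPlayerGame.pd_eq_of_hasFDerivAt {κ : Type} [DecidableEq κ]
    {f : (κ → ℝ) → ℝ} {f' : (κ → ℝ) →L[ℝ] ℝ} {θ : κ → ℝ} (h : HasFDerivAt f f' θ) (k : κ) :
    TwoPlayerGame.pd f k θ = f' (Pi.single k 1) := by
  rw [TwoPlayerGame.pd, h.fderiv]

/-- For `k = 0` the truncated `k - 1` is `0`, in accordance with the convention `θ₋₁ = θ₀`. -/
theorem Algorithm.iterates_succ {κ : Type} [Fintype κ] [DecidableEq κ] (G : TwoPlayerGame κ)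
    (α γ : ℝ) (F : Algorithm κ) (θ₀ : κ → ℝ) (k : ℕ) :
    F.iterates G α γ θ₀ (k + 1) = F.iterates G α γ θ₀ k -
      α • F.direction G α γ (F.iterates G α γ θ₀ (k - 1)) (F.iterates G α γ θ₀ k) := by
  cases k <;> rfl

namespace gameN

open TwoPlayerGame

/-- The interaction term of the game: both `H_o` and `A` equal `rot` at every point. -/
def rot : Matrix (Fin 2) (Fin 2) ℝ := !![0, 1; -1, 0]

theorem rot_mulVec (v : Fin 2 → ℝ) : rot *ᵥ v = ![v 1, -v 0] := by
  ext k
  fin_cases k <;> simp [rot, vecHead, vecTail]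

theorem dotProduct_rot_mulVec_self (v : Fin 2 → ℝ) : v ⬝ᵥ (rot *ᵥ v) = 0 := by
  simp only [rot_mulVec, dotProduct, Fin.sum_univ_two, cons_val_zero, cons_val_one,
    cons_val_fin_one]
  ring

theorem rot_mulVec_dotProduct_self (v : Fin 2 → ℝ) :
    (rot *ᵥ v) ⬝ᵥ (rot *ᵥ v) = v ⬝ᵥ v := by
  simp only [rot_mulVec, dotProduct, Fin.sum_univ_two, cons_val_zero, cons_val_one,
    cons_val_fin_one]
  ring

theorem norm_rot_mulVec (v : Fin 2 → ℝ) : ‖rot *ᵥ v‖ ≤ ‖v‖ := by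
  rw [rot_mulVec, pi_norm_le_iff_of_nonneg (norm_nonneg v), Fin.forall_fin_two]
  simpa [norm_neg] using ⟨norm_le_pi_norm v 1, norm_le_pi_norm v 0⟩

theorem owner_apply (k : Fin 2) : gameN.owner k = k := rfl

theorem loss_zero : gameN.loss 0 =
    fun θ => θ 0 * θ 1 - θ 0 ^ 2 / 2 + θ 1 ^ 2 / 2 + θ 0 ^ 4 / 4 - θ 1 ^ 4 / 4 := rfl

theorem loss_one : gameN.loss 1 = fun θ => -gameN.loss 0 θ := rfl

theorem pd_loss_zero (k : Fin 2) (θ : Fin 2 → ℝ) :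
    pd (gameN.loss 0) k θ = ![θ 1 - θ 0 + θ 0 ^ 3, θ 0 + θ 1 - θ 1 ^ 3] k := by
  have h0 := hasFDerivAt_apply (𝕜 := ℝ) 0 θ
  have h1 := hasFDerivAt_apply (𝕜 := ℝ) 1 θ
  have h := ((((h0.mul h1).sub ((h0.pow 2).mul_const 2⁻¹)).add ((h1.pow 2).mul_const 2⁻¹)).add
    ((h0.pow 4).mul_const 4⁻¹)).sub ((h1.pow 4).mul_const 4⁻¹)
  simp only [loss_zero, div_eq_mul_inv]
  refine (pd_eq_of_hasFDerivAt h k).trans ?_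
  fin_cases k <;> simp

theorem pd_loss_one (k : Fin 2) (θ : Fin 2 → ℝ) :
    pd (gameN.loss 1) k θ = -pd (gameN.loss 0) k θ := by
  simp only [pd, loss_one, fderiv_fun_neg, _root_.neg_apply]

theorem xi_zero (θ : Fin 2 → ℝ) : gameN.xi θ 0 = θ 1 - θ 0 + θ 0 ^ 3 :=
  pd_loss_zero 0 θ

theorem xi_one (θ : Fin 2 → ℝ) : gameN.xi θ 1 = -θ 0 - θ 1 + θ 1 ^ 3 := by
  rw [show gameN.xi θ 1 = pd (gameN.loss 1) 1 θ from rfl, pd_loss_one, pd_loss_zero]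
  simp only [cons_val_one, cons_val_fin_one]
  ring

theorem xi_eq (θ : Fin 2 → ℝ) : gameN.xi θ = rot *ᵥ θ - θ + θ ^ 3 := by
  ext k
  fin_cases k <;> simp [xi_zero, xi_one, rot, vecHead, vecTail]

theorem hess_eq (θ : Fin 2 → ℝ) :
    gameN.hess θ = rot - 1 + diagonal (3 * θ ^ 2) := by
  have h0 := hasFDerivAt_apply (𝕜 := ℝ) 0 θ
  have h1 := hasFDerivAt_apply (𝕜 := ℝ) 1 θ
  have hentry (k l : Fin 2) : gameN.hess θ k l = pd (fun η => gameN.xi η k) l θ := rfl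
  ext k l
  rw [hentry]
  fin_cases k
  · simp only [Fin.zero_eta, xi_zero]
    refine (pd_eq_of_hasFDerivAt ((h1.sub h0).add (h0.pow 3)) l).trans ?_
    fin_cases l <;> simp [rot]
  · simp only [Fin.mk_one, xi_one]
    refine (pd_eq_of_hasFDerivAt ((h0.neg.sub h1).add (h1.pow 3)) l).trans ?_
    fin_cases l <;> simp [rot]

theorem hessOff_eq (θ : Fin 2 → ℝ) : gameN.hessOff θ = rot := by
  ext k l
  fin_cases k <;> fin_cases l <;> simp [hessOff, hess_eq, owner_apply, rot]

theorem hessAnti_eq (θ : Fin 2 → ℝ) : gameN.hessAnti θ = rot := by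
  ext k l
  fin_cases k <;> fin_cases l <;> simp [hessAnti, hess_eq, rot] <;> norm_num

theorem chi_eq (θ : Fin 2 → ℝ) : gameN.chi θ = rot *ᵥ gameN.xi θ := by
  have e (k : Fin 2) : gameN.chi θ k =
    ∑ l, gameN.hessOff θ l k * pd (gameN.loss k) l θ := rfl
  ext k
  rw [e, hessOff_eq, rot_mulVec]
  fin_cases k
  · simp only [Fin.zero_eta, rot, of_apply, cons_val', cons_val_zero, cons_val_one,
      cons_val_fin_one, pd_loss_zero, Fin.sum_univ_two, xi_one]
    ring
  · simp [pd_loss_one, pd_loss_zero, xi_zero, rot]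

theorem hess_transpose_mulVec (θ v : Fin 2 → ℝ) :
    (gameN.hess θ)ᵀ *ᵥ v = -(rot *ᵥ v) - v + 3 * θ ^ 2 * v := by
  ext k
  fin_cases k <;> simp [hess_eq, rot, vecHead, vecTail] <;> ring

theorem rot_transpose_mulVec (v : Fin 2 → ℝ) : rotᵀ *ᵥ v = -(rot *ᵥ v) := by
  ext k
  fin_cases k <;> simp [rot, vecHead, vecTail]

theorem zeroSum : gameN.ZeroSum := fun _ => add_neg_cancel _

theorem analytic : gameN.Analytic := by
  have h (k : Fin 2) : AnalyticOnNhd ℝ (fun θ : Fin 2 → ℝ => θ k) Set.univ :=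
    (ContinuousLinearMap.proj k : (Fin 2 → ℝ) →L[ℝ] ℝ).analyticOnNhd _
  have h_zero : AnalyticOnNhd ℝ (gameN.loss 0) Set.univ := by
    simp only [loss_zero, div_eq_mul_inv]
    exact (((((h 0).mul (h 1)).sub (((h 0).pow 2).mul analyticOnNhd_const)).add
      (((h 1).pow 2).mul analyticOnNhd_const)).add (((h 0).pow 4).mul analyticOnNhd_const)).sub
      (((h 1).pow 4).mul analyticOnNhd_const)
  exact Fin.forall_fin_two.2 ⟨h_zero, h_zero.neg⟩

theorem abs_apply_sub_le_loss (i : Fin 2) (θ : Fin 2 → ℝ) :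
    |θ i| - (θ (i + 1) ^ 4 / 4 + θ (i + 1) ^ 2 / 2 + 4) ≤ gameN.loss i θ := by
  have quartic (c t : ℝ) :
      |t| - (c ^ 2 + 4) ≤ t ^ 4 / 4 + c * t - t ^ 2 / 2 := by
    nlinarith [sq_nonneg (t ^ 2 - 4), sq_nonneg (c + t), sq_nonneg (|t| - 1), sq_abs t]
  fin_cases i
  · have := quartic (θ 1) (θ 0)
    simp only [Fin.zero_eta, zero_add, loss_zero]
    linarith
  · have := quartic (-θ 0) (θ 1)
    simp only [Fin.mk_one, Fin.reduceAdd, loss_one, loss_zero]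
    linarith

theorem weaklyCoercive : gameN.WeaklyCoercive := fun i θ => by
  refine tendsto_atTop_mono' _ ?_ (tendsto_atTop_add_const_right _
    (-(θ (i + 1) ^ 4 / 4 + θ (i + 1) ^ 2 / 2 + 4)) (tendsto_abs_apply_cocompact_inf_principal i θ))
  filter_upwards [mem_inf_of_right (mem_principal_self _)] with η hη
  have h := abs_apply_sub_le_loss i η
  rwa [hη (i + 1) (by fin_cases i <;> decide)] at h

theorem dotProduct_xi (θ : Fin 2 → ℝ) :
    θ ⬝ᵥ gameN.xi θ = θ 0 ^ 4 + θ 1 ^ 4 - θ ⬝ᵥ θ := by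
  simp only [dotProduct, Fin.sum_univ_two, xi_zero, xi_one]
  ring

theorem dotProduct_rot_mulVec_xi (θ : Fin 2 → ℝ) :
    θ ⬝ᵥ (rot *ᵥ gameN.xi θ) = -(θ ⬝ᵥ θ + θ 0 * θ 1 * (θ 0 ^ 2 - θ 1 ^ 2)) := by
  simp only [rot_mulVec, dotProduct, Fin.sum_univ_two, xi_zero, xi_one, cons_val_zero,
    cons_val_one, cons_val_fin_one]
  ring

theorem sq_dotProduct_self_div_two_le (θ : Fin 2 → ℝ) :
    (θ ⬝ᵥ θ) ^ 2 / 2 ≤ θ 0 ^ 4 + θ 1 ^ 4 := by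
  simp only [dotProduct, Fin.sum_univ_two]
  nlinarith [sq_nonneg (θ 0 ^ 2 - θ 1 ^ 2)]

theorem pow_four_add_pow_four_le (θ : Fin 2 → ℝ) :
    θ 0 ^ 4 + θ 1 ^ 4 ≤ (θ ⬝ᵥ θ) ^ 2 := by
  simp only [dotProduct, Fin.sum_univ_two]
  nlinarith [sq_nonneg (θ 0 * θ 1)]

theorem abs_mul_mul_sq_sub_sq_le (θ : Fin 2 → ℝ) :
    |θ 0 * θ 1 * (θ 0 ^ 2 - θ 1 ^ 2)| ≤ (θ ⬝ᵥ θ) ^ 2 / 4 := by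
  simp only [dotProduct, Fin.sum_univ_two]
  exact abs_le.2 ⟨by nlinarith [sq_nonneg (θ 0 ^ 2 - θ 1 ^ 2 + 2 * (θ 0 * θ 1))],
    by nlinarith [sq_nonneg (θ 0 ^ 2 - θ 1 ^ 2 - 2 * (θ 0 * θ 1))]⟩

theorem xi_dotProduct_self_le (θ : Fin 2 → ℝ) :
    gameN.xi θ ⬝ᵥ gameN.xi θ ≤ 2 * (θ ⬝ᵥ θ) + (θ ⬝ᵥ θ) ^ 3 := by
  have hcross := (abs_le.1 (abs_mul_mul_sq_sub_sq_le θ)).2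
  have hquartic := sq_dotProduct_self_div_two_le θ
  have hpos : 0 ≤ θ 0 ^ 2 * θ 1 ^ 2 * (θ 0 ^ 2 + θ 1 ^ 2) := by positivity
  simp only [dotProduct, Fin.sum_univ_two, xi_zero, xi_one] at hcross hquartic ⊢
  nlinarith [sq_nonneg (θ 0 * θ 0 + θ 1 * θ 1)]

theorem isCritical_zero : gameN.IsCritical 0 := by
  simp [IsCritical, xi_eq]

theorem eq_zero_of_isCritical {θ : Fin 2 → ℝ} (h : gameN.IsCritical θ) : θ = 0 := by
  rw [IsCritical] at h
  have hxi := dotProduct_xi θ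
  have hrot := dotProduct_rot_mulVec_xi θ
  rw [h, dotProduct_zero] at hxi
  rw [h, mulVec_zero, dotProduct_zero] at hrot
  refine dotProduct_self_eq_zero.1 (le_antisymm ?_ (dotProduct_self_nonneg θ))
  linarith [sq_dotProduct_self_div_two_le θ, neg_abs_le (θ 0 * θ 1 * (θ 0 ^ 2 - θ 1 ^ 2)),
    abs_mul_mul_sq_sub_sq_le θ, sq_nonneg (θ ⬝ᵥ θ)]

theorem hess_zero : gameN.hess 0 = rot - 1 := by
  simp [hess_eq]

theorem isStrictMax_zero : gameN.IsStrictMax 0 := by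
  refine ⟨isCritical_zero, fun u hu => ?_⟩
  rw [hess_zero, sub_mulVec, one_mulVec, dotProduct_sub, dotProduct_rot_mulVec_self, zero_sub,
    neg_lt_zero]
  exact (dotProduct_self_nonneg u).lt_of_ne' (dotProduct_self_eq_zero.not.2 hu)

theorem nondegenerate : gameN.Nondegenerate := fun θ h => by
  rw [eq_zero_of_isCritical h, isUnit_iff_isUnit_det, hess_zero]
  simp [rot, det_fin_two]

theorem continuous_xi : Continuous gameN.xi := by
  simp only [funext xi_eq]
  fun_prop

theorem norm_xi_sub_le {a b : Fin 2 → ℝ} {s : ℝ} (ha : ‖a‖ ≤ s) (hb : ‖b‖ ≤ s) :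
    ‖gameN.xi a - gameN.xi b‖ ≤ (2 + 3 * s ^ 2) * ‖a - b‖ := by
  have hcube : ‖a ^ 3 - b ^ 3‖ ≤ 3 * s ^ 2 * ‖a - b‖ := by
    simpa using norm_pow_sub_pow_le ha hb 3
  calc ‖gameN.xi a - gameN.xi b‖
      = ‖rot *ᵥ (a - b) - (a - b) + (a ^ 3 - b ^ 3)‖ := by
        rw [xi_eq, xi_eq, mulVec_sub]
        congr 1
        abel
    _ ≤ ‖a - b‖ + ‖a - b‖ + 3 * s ^ 2 * ‖a - b‖ :=
        norm_add_le_of_le (norm_sub_le_of_le (norm_rot_mulVec _) le_rfl) hcube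
    _ = (2 + 3 * s ^ 2) * ‖a - b‖ := by ring

theorem norm_hess_transpose_mulVec_le {θ : Fin 2 → ℝ} {s : ℝ} (hθ : ‖θ‖ ≤ s)
    (v : Fin 2 → ℝ) : ‖(gameN.hess θ)ᵀ *ᵥ v‖ ≤ (2 + 3 * s ^ 2) * ‖v‖ := by
  have hsq : ‖3 * θ ^ 2 * v‖ ≤ 3 * s ^ 2 * ‖v‖ := by
    have h3 : ‖(3 : Fin 2 → ℝ)‖ ≤ 3 :=
      (pi_norm_le_iff_of_nonneg zero_le_three).2 fun _ => (Real.norm_ofNat 3).le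
    exact norm_mul_le_of_le (norm_mul_le_of_le h3
      ((norm_pow_le θ 2).trans (pow_le_pow_left₀ (norm_nonneg θ) hθ 2))) le_rfl
  rw [hess_transpose_mulVec]
  calc ‖-(rot *ᵥ v) - v + 3 * θ ^ 2 * v‖ ≤ ‖v‖ + ‖v‖ + 3 * s ^ 2 * ‖v‖ :=
        norm_add_le_of_le (norm_sub_le_of_le ((norm_neg _).trans_le (norm_rot_mulVec v)) le_rfl)
          hsq
    _ = (2 + 3 * s ^ 2) * ‖v‖ := by ring

/-- The update direction `d` at `θ` is, up to an error of small relative size, an `SGA` direction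
`(I + l Aᵀ) ξ`, where `l` does not turn the step towards the critical point when `θ` is near it.
Every algorithm moves in such a direction. On the disc `θ ⬝ᵥ θ ≤ 1 / 3` the symmetric part of the
Hessian, `diag (3 x² - 1, 3 y² - 1)`, is still negative semidefinite, which decides the sign of the
`SGA` parameter. -/
def IsNearSGA (θ d : Fin 2 → ℝ) : Prop :=
  ∃ (l : ℝ) (e : Fin 2 → ℝ), |l| ≤ 1 ∧ (θ ⬝ᵥ θ ≤ 1 / 3 → l ≤ 0) ∧
    128 * (e ⬝ᵥ e) ≤ gameN.xi θ ⬝ᵥ gameN.xi θ ∧ d = gameN.xi θ - l • (rot *ᵥ gameN.xi θ) + e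

theorem dotProduct_self_sub_smul_rot_mulVec (v : Fin 2 → ℝ) (l : ℝ) :
    (v - l • (rot *ᵥ v)) ⬝ᵥ (v - l • (rot *ᵥ v)) = (1 + l ^ 2) * (v ⬝ᵥ v) := by
  rw [dotProduct_self_sub_smul, dotProduct_rot_mulVec_self, rot_mulVec_dotProduct_self]
  ring

theorem abs_dotProduct_le_of_small {θ e : Fin 2 → ℝ}
    (he : 128 * (e ⬝ᵥ e) ≤ gameN.xi θ ⬝ᵥ gameN.xi θ) :
    |θ ⬝ᵥ e| ≤ (θ ⬝ᵥ θ + (θ ⬝ᵥ θ) ^ 2) / 8 := by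
  have hr := dotProduct_self_nonneg θ
  refine abs_le_of_sq_le_sq ((sq_dotProduct_le θ e).trans ?_) (by positivity)
  have hrr : 0 ≤ (θ ⬝ᵥ θ) ^ 3 := by positivity
  nlinarith [mul_le_mul_of_nonneg_left (he.trans (xi_dotProduct_self_le θ)) hr]

namespace IsNearSGA

variable {θ d : Fin 2 → ℝ}

theorem of_norm_sub_le (h : ‖d - gameN.xi θ‖ ≤ ‖gameN.xi θ‖ / 16) : IsNearSGA θ d := by
  refine ⟨0, d - gameN.xi θ, by simp, fun _ => le_rfl, ?_, by simp⟩
  have hcard := dotProduct_self_le_card_mul_sq_norm (d - gameN.xi θ)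
  rw [Fintype.card_fin, Nat.cast_ofNat] at hcard
  have hsq : ‖d - gameN.xi θ‖ ^ 2 ≤ (‖gameN.xi θ‖ / 16) ^ 2 := by gcongr
  linarith [sq_norm_le_dotProduct_self (gameN.xi θ)]

theorem dotProduct_self_le (h : IsNearSGA θ d) :
    d ⬝ᵥ d ≤ 5 * (gameN.xi θ ⬝ᵥ gameN.xi θ) := by
  obtain ⟨l, e, hl, -, he, rfl⟩ := h
  refine (dotProduct_self_add_le _ _).trans ?_
  rw [dotProduct_self_sub_smul_rot_mulVec]
  have hsq := mul_le_of_le_one_left (dotProduct_self_nonneg (gameN.xi θ))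
    ((sq_le_one_iff_abs_le_one l).2 hl)
  linarith [dotProduct_self_nonneg (gameN.xi θ)]

theorem xi_dotProduct_self_le (h : IsNearSGA θ d) :
    gameN.xi θ ⬝ᵥ gameN.xi θ ≤ 4 * (d ⬝ᵥ d) := by
  obtain ⟨l, e, -, -, he, rfl⟩ := h
  set d := gameN.xi θ - l • (rot *ᵥ gameN.xi θ) + e with hd
  have hsplit := dotProduct_self_add_le d (-e)
  rw [hd, add_neg_cancel_right, dotProduct_self_sub_smul_rot_mulVec, ← hd,
    neg_dotProduct_neg] at hsplit
  linarith [mul_nonneg (sq_nonneg l) (dotProduct_self_nonneg (gameN.xi θ)),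
    dotProduct_self_nonneg d, dotProduct_self_nonneg (gameN.xi θ)]

theorem norm_le (h : IsNearSGA θ d) : ‖d‖ ≤ 3 * ‖gameN.xi θ‖ := by
  obtain ⟨l, e, hl, -, he, rfl⟩ := h
  have hcard := dotProduct_self_le_card_mul_sq_norm (gameN.xi θ)
  rw [Fintype.card_fin, Nat.cast_ofNat] at hcard
  have he' : ‖e‖ ≤ ‖gameN.xi θ‖ :=
    norm_le_of_dotProduct_self_le_sq (norm_nonneg _) (by linarith [dotProduct_self_nonneg e])
  have hrot : ‖l • (rot *ᵥ gameN.xi θ)‖ ≤ ‖gameN.xi θ‖ :=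
    (norm_smul_le _ _).trans
      ((mul_le_of_le_one_left (norm_nonneg _) hl).trans (norm_rot_mulVec _))
  exact (norm_add_le_of_le (norm_sub_le_of_le le_rfl hrot) he').trans_eq (by ring)

theorem dotProduct_nonpos (h : IsNearSGA θ d) (hθ : θ ⬝ᵥ θ ≤ 1 / 3) : θ ⬝ᵥ d ≤ 0 := by
  obtain ⟨l, e, -, hl, he, rfl⟩ := h
  have hr := dotProduct_self_nonneg θ
  have hrot : θ ⬝ᵥ (rot *ᵥ gameN.xi θ) ≤ 0 := by
    rw [dotProduct_rot_mulVec_xi]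
    nlinarith [neg_abs_le (θ 0 * θ 1 * (θ 0 ^ 2 - θ 1 ^ 2)), abs_mul_mul_sq_sub_sq_le θ]
  rw [dotProduct_add, dotProduct_sub, dotProduct_smul, smul_eq_mul, dotProduct_xi]
  nlinarith [mul_nonneg_of_nonpos_of_nonpos (hl hθ) hrot, pow_four_add_pow_four_le θ,
    le_abs_self (θ ⬝ᵥ e), abs_dotProduct_le_of_small he]

theorem one_le_dotProduct (h : IsNearSGA θ d) (hθ : 32 ≤ θ ⬝ᵥ θ) : 1 ≤ θ ⬝ᵥ d := by
  obtain ⟨l, e, hl, -, he, rfl⟩ := h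
  have hrot : |l * (θ ⬝ᵥ (rot *ᵥ gameN.xi θ))| ≤ θ ⬝ᵥ θ + (θ ⬝ᵥ θ) ^ 2 / 4 := by
    rw [abs_mul, dotProduct_rot_mulVec_xi, abs_neg]
    refine (mul_le_of_le_one_left (abs_nonneg _) hl).trans ((abs_add_le _ _).trans ?_)
    rw [abs_of_nonneg (dotProduct_self_nonneg θ)]
    gcongr
    exact abs_mul_mul_sq_sub_sq_le θ
  rw [dotProduct_add, dotProduct_sub, dotProduct_smul, smul_eq_mul, dotProduct_xi]
  nlinarith [le_abs_self (l * (θ ⬝ᵥ (rot *ᵥ gameN.xi θ))), sq_dotProduct_self_div_two_le θ,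
    neg_abs_le (θ ⬝ᵥ e), abs_dotProduct_le_of_small he]

end IsNearSGA

/-- The rate `β` is small enough for all estimates on the disc of radius `ρ`, which is large enough
to be trapping. Both the learning rate `α` and the hyperparameter `γ` are of this kind. The sixth
power is the growth of `ξ ⬝ᵥ ξ`, hence of the squared length of a step. -/
structure SmallRate (ρ β : ℝ) : Prop where
  radius_ge : 8 ≤ ρ
  pos : 0 < β
  mul_pow_le : β * ρ ^ 6 ≤ 1 / 64

namespace SmallRate

variable {ρ β : ℝ} {θ d : Fin 2 → ℝ}

theorem mul_lipschitz_le (h : SmallRate ρ β) : β * (2 + 3 * (2 * ρ) ^ 2) ≤ 1 / 64 := by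
  have hρ : 2 + 3 * (2 * ρ) ^ 2 ≤ ρ ^ 6 := by
    have h2 : (8 : ℝ) ^ 2 ≤ ρ ^ 2 := by gcongr; exact h.radius_ge
    have h4 : (8 : ℝ) ^ 4 ≤ ρ ^ 4 := by gcongr; exact h.radius_ge
    nlinarith
  exact (mul_le_mul_of_nonneg_left hρ h.pos.le).trans h.mul_pow_le

theorem le (h : SmallRate ρ β) : β ≤ 1 / 128 := by
  nlinarith [h.mul_lipschitz_le, h.pos, mul_nonneg h.pos.le (sq_nonneg (2 * ρ))]

theorem mul_lipschitz_mul_le (h : SmallRate ρ β) {t : ℝ} (ht : 0 ≤ t) :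
    β * ((2 + 3 * (2 * ρ) ^ 2) * t) ≤ t / 64 := by
  linarith [mul_le_mul_of_nonneg_right h.mul_lipschitz_le ht]

theorem mul_norm_xi_sub_le (h : SmallRate ρ β) {a b : Fin 2 → ℝ} (ha : ‖a‖ ≤ 2 * ρ)
    (hb : ‖b‖ ≤ 2 * ρ) : β * ‖gameN.xi a - gameN.xi b‖ ≤ ‖a - b‖ / 64 :=
  (mul_le_mul_of_nonneg_left (norm_xi_sub_le ha hb) h.pos.le).trans
    (h.mul_lipschitz_mul_le (norm_nonneg _))

theorem norm_xi_sub_le_of_norm_sub_le (h : SmallRate ρ β) {a b : Fin 2 → ℝ} {c : ℝ}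
    (ha : ‖a‖ ≤ 2 * ρ) (hb : ‖b‖ ≤ 2 * ρ) (hab : ‖a - b‖ ≤ β * c) :
    ‖gameN.xi a - gameN.xi b‖ ≤ c / 64 :=
  le_of_mul_le_mul_left ((h.mul_norm_xi_sub_le ha hb).trans (by linarith)) h.pos

theorem mul_norm_xi_le (h : SmallRate ρ β) (hθ : ‖θ‖ ≤ 2 * ρ) : β * ‖gameN.xi θ‖ ≤ ‖θ‖ / 64 := by
  have hzero : ‖(0 : Fin 2 → ℝ)‖ ≤ 2 * ρ := by
    rw [norm_zero]
    linarith [h.radius_ge]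
  simpa only [show gameN.xi 0 = 0 from isCritical_zero, sub_zero] using
    h.mul_norm_xi_sub_le hθ hzero

theorem mul_norm_hess_transpose_mulVec_le (h : SmallRate ρ β) (hθ : ‖θ‖ ≤ 2 * ρ)
    (v : Fin 2 → ℝ) : β * ‖(gameN.hess θ)ᵀ *ᵥ v‖ ≤ ‖v‖ / 64 :=
  (mul_le_mul_of_nonneg_left (norm_hess_transpose_mulVec_le hθ v) h.pos.le).trans
    (h.mul_lipschitz_mul_le (norm_nonneg v))

theorem norm_le_of_mem_disc (h : SmallRate ρ β) (hθ : θ ⬝ᵥ θ ≤ ρ ^ 2) : ‖θ‖ ≤ ρ :=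
  norm_le_of_dotProduct_self_le_sq (by linarith [h.radius_ge]) hθ

theorem norm_le_two_mul (h : SmallRate ρ β) (hθ : ‖θ‖ ≤ ρ) : ‖θ‖ ≤ 2 * ρ := by
  linarith [h.radius_ge]

theorem mul_dotProduct_self_le (h : SmallRate ρ β) (hd : IsNearSGA θ d)
    (hθ : θ ⬝ᵥ θ ≤ ρ ^ 2) : β * (d ⬝ᵥ d) ≤ 1 / 8 := by
  have hxi : gameN.xi θ ⬝ᵥ gameN.xi θ ≤ 2 * ρ ^ 2 + (ρ ^ 2) ^ 3 := by
    refine (xi_dotProduct_self_le θ).trans ?_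
    have := dotProduct_self_nonneg θ
    gcongr
  have hbound : d ⬝ᵥ d ≤ 5 * ρ ^ 6 + (2 + 3 * (2 * ρ) ^ 2) := by
    linarith [hd.dotProduct_self_le, sq_nonneg ρ, pow_mul ρ 2 3]
  linarith [mul_le_mul_of_nonneg_left hbound h.pos.le, h.mul_pow_le, h.mul_lipschitz_le]

theorem dotProduct_self_le_step (h : SmallRate ρ β) (hd : IsNearSGA θ d)
    (hθ : θ ⬝ᵥ θ ≤ 1 / 3) : θ ⬝ᵥ θ ≤ (θ - β • d) ⬝ᵥ (θ - β • d) := by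
  rw [dotProduct_self_sub_smul]
  linarith [mul_nonpos_of_nonneg_of_nonpos h.pos.le (hd.dotProduct_nonpos hθ),
    mul_nonneg (sq_nonneg β) (dotProduct_self_nonneg d)]

theorem step_mem_disc (h : SmallRate ρ β) (hd : IsNearSGA θ d) (hθ : θ ⬝ᵥ θ ≤ ρ ^ 2) :
    (θ - β • d) ⬝ᵥ (θ - β • d) ≤ ρ ^ 2 := by
  have hdd := h.mul_dotProduct_self_le hd hθ
  have hβ := h.le
  have hpos := h.pos
  rw [dotProduct_self_sub_smul]
  rcases le_total 32 (θ ⬝ᵥ θ) with hfar | hnear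
  · nlinarith [hd.one_le_dotProduct hfar]
  · have hcross := (abs_le.1 (abs_two_mul_dotProduct_le θ d)).1
    have hρ : (8 : ℝ) ^ 2 ≤ ρ ^ 2 := by gcongr; exact h.radius_ge
    nlinarith

theorem dotProduct_self_step_pos (h : SmallRate ρ β) (hd : IsNearSGA θ d) (hθ : θ ⬝ᵥ θ ≤ ρ ^ 2)
    (hpos : 0 < θ ⬝ᵥ θ) : 0 < (θ - β • d) ⬝ᵥ (θ - β • d) := by
  rcases le_total (θ ⬝ᵥ θ) (1 / 3) with hnear | hfar
  · exact hpos.trans_le (h.dotProduct_self_le_step hd hnear)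
  · have hcross := (abs_le.1 (abs_two_mul_dotProduct_le θ d)).2
    rw [dotProduct_self_sub_smul]
    nlinarith [h.mul_dotProduct_self_le hd hθ, h.le, h.pos,
      mul_nonneg (sq_nonneg β) (dotProduct_self_nonneg d)]

theorem norm_step_sub_le (h : SmallRate ρ β) (hd : IsNearSGA θ d) (hθ : θ ⬝ᵥ θ ≤ ρ ^ 2) :
    ‖θ - β • d - θ‖ ≤ β * (4 * ‖gameN.xi (θ - β • d)‖) := by
  have hstep : ‖θ - β • d - θ‖ ≤ β * (3 * ‖gameN.xi θ‖) := by
    rw [sub_sub_cancel_left, norm_neg, norm_smul, Real.norm_of_nonneg h.pos.le]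
    exact mul_le_mul_of_nonneg_left hd.norm_le h.pos.le
  have hxi : ‖gameN.xi (θ - β • d) - gameN.xi θ‖ ≤ 3 * ‖gameN.xi θ‖ / 64 :=
    h.norm_xi_sub_le_of_norm_sub_le
      (h.norm_le_two_mul (h.norm_le_of_mem_disc (h.step_mem_disc hd hθ)))
      (h.norm_le_two_mul (h.norm_le_of_mem_disc hθ)) hstep
  refine hstep.trans (mul_le_mul_of_nonneg_left ?_ h.pos.le)
  linarith [norm_sub_norm_le (gameN.xi θ) (gameN.xi (θ - β • d)),
    norm_sub_rev (gameN.xi θ) (gameN.xi (θ - β • d)), norm_nonneg (gameN.xi θ)]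

end SmallRate

theorem SmallRate.exists_tendsto_prox {ρ α : ℝ} {θ : Fin 2 → ℝ} (h : SmallRate ρ α)
    (hθ : ‖θ‖ ≤ ρ) :
    ∃ η, Tendsto (gameN.prox α θ) atTop (𝓝 η) ∧ ‖η‖ ≤ 2 * ρ ∧ θ + α • gameN.xi η = η := by
  set B := Metric.closedBall (0 : Fin 2 → ℝ) (2 * ρ)
  have hmaps : Set.MapsTo (fun η => θ + α • gameN.xi η) B B := fun η hη => by
    rw [mem_closedBall_zero_iff] at hη ⊢
    refine (norm_add_le _ _).trans ?_
    rw [norm_smul, Real.norm_of_nonneg h.pos.le]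
    linarith [h.mul_norm_xi_le hη, norm_nonneg θ]
  have hcontr : ContractingWith (1 / 64) (hmaps.restrict (fun η => θ + α • gameN.xi η) B B) := by
    refine ⟨by norm_num, LipschitzWith.of_dist_le_mul fun a b => ?_⟩
    rw [Subtype.dist_eq, Subtype.dist_eq, Set.MapsTo.val_restrict_apply,
      Set.MapsTo.val_restrict_apply, dist_add_left, dist_eq_norm, ← smul_sub, norm_smul,
      Real.norm_of_nonneg h.pos.le, dist_eq_norm]
    refine (h.mul_norm_xi_sub_le (mem_closedBall_zero_iff.1 a.2)
      (mem_closedBall_zero_iff.1 b.2)).trans_eq ?_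
    rw [div_eq_inv_mul]
    norm_num
  obtain ⟨η, hη, hfix, htendsto, -⟩ := hcontr.exists_fixedPoint'
    Metric.isClosed_closedBall.isComplete hmaps
    (mem_closedBall_zero_iff.2 (h.norm_le_two_mul hθ)) (edist_ne_top _ _)
  exact ⟨η, htendsto, mem_closedBall_zero_iff.1 hη, hfix⟩

theorem isUnit_one_add_smul_rot (α : ℝ) : IsUnit (1 + α • rot) := by
  rw [isUnit_iff_isUnit_det, isUnit_iff_ne_zero]
  have hdet : (1 + α • rot).det = 1 + α ^ 2 := by
    simp [rot, det_fin_two, sq]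
  rw [hdet]
  positivity

theorem dotProduct_hess_transpose_mulVec_nonpos {θ : Fin 2 → ℝ} (hθ : θ ⬝ᵥ θ ≤ 1 / 3)
    (v : Fin 2 → ℝ) : v ⬝ᵥ ((gameN.hess θ)ᵀ *ᵥ v) ≤ 0 := by
  simp only [hess_transpose_mulVec, rot_mulVec, dotProduct, Fin.sum_univ_two, Pi.add_apply,
    Pi.sub_apply, Pi.neg_apply, Pi.mul_apply, Pi.pow_apply, Pi.ofNat_apply, cons_val_zero,
    cons_val_one, cons_val_fin_one] at hθ ⊢
  have h0 : 0 ≤ (1 - 3 * θ 0 ^ 2) * v 0 ^ 2 :=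
    mul_nonneg (by linarith [mul_self_nonneg (θ 1)]) (sq_nonneg _)
  have h1 : 0 ≤ (1 - 3 * θ 1 ^ 2) * v 1 ^ 2 :=
    mul_nonneg (by linarith [mul_self_nonneg (θ 0)]) (sq_nonneg _)
  linarith

theorem rot_transpose_mulVec_dotProduct_nonneg {θ : Fin 2 → ℝ} (hθ : θ ⬝ᵥ θ ≤ 1 / 3)
    (v : Fin 2 → ℝ) : 0 ≤ (rotᵀ *ᵥ v) ⬝ᵥ ((gameN.hess θ)ᵀ *ᵥ v) := by
  simp only [hess_transpose_mulVec, rot_transpose_mulVec, rot_mulVec, dotProduct,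
    Fin.sum_univ_two, Pi.add_apply, Pi.sub_apply, Pi.neg_apply, Pi.mul_apply, Pi.pow_apply,
    Pi.ofNat_apply, cons_val_zero, cons_val_one, cons_val_fin_one] at hθ ⊢
  -- `(Aᵀ v) ⬝ (Hᵀ v) = v ⬝ v + 3 (y² - x²) v₀ v₁`, and `v₀ v₁` is diagonalized by `v₀ ± v₁`.
  have h_add : 0 ≤ (1 + 3 / 2 * (θ 1 ^ 2 - θ 0 ^ 2)) * (v 0 + v 1) ^ 2 :=
    mul_nonneg (by linarith [mul_self_nonneg (θ 1)]) (sq_nonneg _)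
  have h_sub : 0 ≤ (1 - 3 / 2 * (θ 1 ^ 2 - θ 0 ^ 2)) * (v 0 - v 1) ^ 2 :=
    mul_nonneg (by linarith [mul_self_nonneg (θ 0)]) (sq_nonneg _)
  linarith

theorem isNearSGA_sub_smul_rot_mulVec_xi (θ : Fin 2 → ℝ) {c : ℝ} (hc : |c| ≤ 1 / 16) :
    IsNearSGA θ (gameN.xi θ - c • (rot *ᵥ gameN.xi θ)) := by
  refine .of_norm_sub_le ?_
  rw [sub_sub_cancel_left, norm_neg, norm_smul, div_eq_inv_mul, ← one_div]
  exact mul_le_mul hc (norm_rot_mulVec _) (norm_nonneg _) (by norm_num)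

section direction

variable {ρ α γ : ℝ} {prev θ : Fin 2 → ℝ}

theorem isNearSGA_gd : IsNearSGA θ (Algorithm.gd.direction gameN α γ prev θ) :=
  .of_norm_sub_le (by rw [Algorithm.direction, sub_self, norm_zero]; positivity)

theorem isNearSGA_agd (hα : SmallRate ρ α) :
    IsNearSGA θ (Algorithm.agd.direction gameN α γ prev θ) := by
  have hd : Algorithm.agd.direction gameN α γ prev θ - gameN.xi θ = ![0, α * gameN.xi θ 0] := by
    ext k
    fin_cases k <;> simp [Algorithm.direction, owner_apply, xi_one]
  have hα_le : α ≤ 1 / 16 := hα.le.trans (by norm_num)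
  refine .of_norm_sub_le ?_
  rw [hd, pi_norm_le_iff_of_nonneg (by positivity), Fin.forall_fin_two]
  constructor
  · rw [cons_val_zero, norm_zero]
    positivity
  · rw [cons_val_one, cons_val_fin_one, norm_mul, Real.norm_of_nonneg hα.pos.le]
    linarith [mul_le_mul hα_le (norm_le_pi_norm (gameN.xi θ) 0) (norm_nonneg _) (by norm_num)]

theorem isNearSGA_eg (hα : SmallRate ρ α) (hθ : ‖θ‖ ≤ ρ) :
    IsNearSGA θ (Algorithm.eg.direction gameN α γ prev θ) := by
  have hstep : ‖α • gameN.xi θ‖ = α * ‖gameN.xi θ‖ := by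
    rw [norm_smul, Real.norm_of_nonneg hα.pos.le]
  have hmid : ‖θ - α • gameN.xi θ‖ ≤ 2 * ρ := by
    linarith [norm_sub_le θ (α • gameN.xi θ), hα.mul_norm_xi_le (hα.norm_le_two_mul hθ),
      norm_nonneg θ]
  refine .of_norm_sub_le ((hα.norm_xi_sub_le_of_norm_sub_le hmid (hα.norm_le_two_mul hθ)
    (c := ‖gameN.xi θ‖) ?_).trans ?_)
  · rw [sub_sub_cancel_left, norm_neg, hstep]
  · linarith [norm_nonneg (gameN.xi θ)]

theorem isNearSGA_omd (hα : SmallRate ρ α) (hθ : ‖θ‖ ≤ ρ) (hprev : ‖prev‖ ≤ ρ)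
    (hdisp : ‖θ - prev‖ ≤ α * (4 * ‖gameN.xi θ‖)) :
    IsNearSGA θ (Algorithm.omd.direction gameN α γ prev θ) := by
  refine .of_norm_sub_le ?_
  rw [Algorithm.direction, two_smul, add_sub_assoc, add_sub_cancel_left]
  refine (hα.norm_xi_sub_le_of_norm_sub_le (hα.norm_le_two_mul hθ) (hα.norm_le_two_mul hprev)
    hdisp).trans_eq ?_
  ring

theorem isNearSGA_omdProx (hα : SmallRate ρ α) (hθ : ‖θ‖ ≤ ρ) :
    IsNearSGA θ (Algorithm.omdProx.direction gameN α γ prev θ) := by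
  obtain ⟨η, hη_tendsto, hη, hη_eq⟩ := hα.exists_tendsto_prox hθ
  have hdist : ‖θ - η‖ ≤ α * ‖gameN.xi η‖ := by
    nth_rewrite 1 [← hη_eq]
    rw [sub_add_cancel_left, norm_neg, norm_smul, Real.norm_of_nonneg hα.pos.le]
  have hxi := hα.norm_xi_sub_le_of_norm_sub_le (hα.norm_le_two_mul hθ) hη hdist
  refine .of_norm_sub_le ?_
  rw [Algorithm.direction, TwoPlayerGame.proxInv, hη_tendsto.limUnder_eq, two_smul,
    add_sub_assoc, add_sub_cancel_left]
  linarith [norm_sub_norm_le (gameN.xi η) (gameN.xi θ),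
    norm_sub_rev (gameN.xi η) (gameN.xi θ), norm_nonneg (gameN.xi η)]

theorem isNearSGA_sga : IsNearSGA θ (Algorithm.sga.direction gameN α γ prev θ) := by
  refine ⟨Real.sign ((gameN.xi θ ⬝ᵥ ((gameN.hess θ)ᵀ *ᵥ gameN.xi θ)) *
    ((rotᵀ *ᵥ gameN.xi θ) ⬝ᵥ ((gameN.hess θ)ᵀ *ᵥ gameN.xi θ))), 0, abs_sign_le_one _,
    fun hθ => ?_, ?_, ?_⟩
  · exact sign_nonpos (mul_nonpos_of_nonpos_of_nonneg
      (dotProduct_hess_transpose_mulVec_nonpos hθ _) (rot_transpose_mulVec_dotProduct_nonneg hθ _))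
  · rw [zero_dotProduct, mul_zero]
    exact dotProduct_self_nonneg _
  · rw [Algorithm.direction, hessAnti_eq, add_mulVec, one_mulVec, smul_mulVec,
      rot_transpose_mulVec, smul_neg, sub_eq_add_neg, add_zero]

theorem isNearSGA_co (hγ : SmallRate ρ γ) (hθ : ‖θ‖ ≤ ρ) :
    IsNearSGA θ (Algorithm.co.direction gameN α γ prev θ) := by
  refine .of_norm_sub_le ?_
  rw [Algorithm.direction, add_mulVec, one_mulVec, add_sub_cancel_left, smul_mulVec, norm_smul,
    Real.norm_of_nonneg hγ.pos.le]
  linarith [hγ.mul_norm_hess_transpose_mulVec_le (hγ.norm_le_two_mul hθ) (gameN.xi θ),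
    norm_nonneg (gameN.xi θ)]

theorem isNearSGA_cgd (hα : SmallRate ρ α) :
    IsNearSGA θ (Algorithm.cgd.direction gameN α γ prev θ) := by
  rw [Algorithm.direction, hessOff_eq]
  set d := (1 + α • rot)⁻¹ *ᵥ gameN.xi θ with hd
  have hsolves : (1 + α • rot) *ᵥ d = gameN.xi θ := by
    rw [hd, mulVec_mulVec, mul_nonsing_inv _
      ((isUnit_iff_isUnit_det _).1 (isUnit_one_add_smul_rot α)), one_mulVec]
  rw [add_mulVec, one_mulVec, smul_mulVec] at hsolves
  have hnorm : ‖d - gameN.xi θ‖ ≤ 1 / 128 * ‖d‖ := by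
    rw [← hsolves, sub_add_cancel_left, norm_neg, norm_smul, Real.norm_of_nonneg hα.pos.le]
    exact mul_le_mul hα.le (norm_rot_mulVec d) (norm_nonneg _) (by norm_num)
  refine .of_norm_sub_le ?_
  linarith [norm_sub_norm_le d (gameN.xi θ), norm_nonneg (gameN.xi θ)]

theorem isNearSGA_la (hα : SmallRate ρ α) :
    IsNearSGA θ (Algorithm.la.direction gameN α γ prev θ) := by
  rw [Algorithm.direction, hessOff_eq, sub_mulVec, one_mulVec, smul_mulVec]
  exact isNearSGA_sub_smul_rot_mulVec_xi θ
    ((abs_of_pos hα.pos).trans_le (hα.le.trans (by norm_num)))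

theorem isNearSGA_sos (hα : SmallRate ρ α) (p : (Fin 2 → ℝ) → ℝ)
    (hp : ∀ θ, p θ ∈ Set.Icc (0 : ℝ) 1) :
    IsNearSGA θ ((Algorithm.sos p hp).direction gameN α γ prev θ) := by
  rw [Algorithm.direction, hessOff_eq, chi_eq, sub_mulVec, one_mulVec, smul_mulVec, sub_sub,
    ← add_smul]
  have hpα : p θ * α ≤ α := mul_le_of_le_one_left hα.pos.le (hp θ).2
  have hpα_nonneg : 0 ≤ p θ * α := mul_nonneg (hp θ).1 hα.pos.le
  refine isNearSGA_sub_smul_rot_mulVec_xi θ ?_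
  rw [abs_of_nonneg (by linarith [hα.pos])]
  linarith [hα.le]

theorem isNearSGA_lola (hα : SmallRate ρ α) :
    IsNearSGA θ (Algorithm.lola.direction gameN α γ prev θ) := by
  simpa only [Algorithm.direction, one_mul] using
    isNearSGA_sos (γ := γ) (prev := prev) hα (fun _ => 1) fun _ => ⟨zero_le_one, le_rfl⟩

theorem isNearSGA_direction (hα : SmallRate ρ α) (hγ : SmallRate ρ γ) (hθ : ‖θ‖ ≤ ρ)
    (hprev : ‖prev‖ ≤ ρ) (hdisp : ‖θ - prev‖ ≤ α * (4 * ‖gameN.xi θ‖)) :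
    ∀ F : Algorithm (Fin 2), IsNearSGA θ (F.direction gameN α γ prev θ)
  | .gd => isNearSGA_gd
  | .agd => isNearSGA_agd hα
  | .eg => isNearSGA_eg hα hθ
  | .omd => isNearSGA_omd hα hθ hprev hdisp
  | .omdProx => isNearSGA_omdProx hα hθ
  | .sga => isNearSGA_sga
  | .co => isNearSGA_co hγ hθ
  | .cgd => isNearSGA_cgd hα
  | .la => isNearSGA_la hα
  | .lola => isNearSGA_lola hα
  | .sos p hp => isNearSGA_sos hα p hp

end direction

theorem stepDefined {ρ α : ℝ} {θ : Fin 2 → ℝ} (hα : SmallRate ρ α) (hθ : ‖θ‖ ≤ ρ)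
    (F : Algorithm (Fin 2)) : F.StepDefined gameN α θ := by
  cases F
  case cgd => simpa only [Algorithm.StepDefined, hessOff_eq] using isUnit_one_add_smul_rot α
  case omdProx =>
    obtain ⟨η, hη, -⟩ := hα.exists_tendsto_prox hθ
    exact ⟨η, hη⟩
  all_goals trivial

/-- The pair `(prev, θ)` of consecutive iterates, whose displacement is controlled by `ξ` at the
later one, lies in the disc of radius `ρ`, with `θ` off the critical point. This is the invariant
of every algorithm; the control of the displacement is what `omd` needs of its memory. -/
structure Trapped (ρ α : ℝ) (prev θ : Fin 2 → ℝ) : Prop where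
  prev_mem_disc : prev ⬝ᵥ prev ≤ ρ ^ 2
  mem_disc : θ ⬝ᵥ θ ≤ ρ ^ 2
  pos : 0 < θ ⬝ᵥ θ
  norm_sub_le : ‖θ - prev‖ ≤ α * (4 * ‖gameN.xi θ‖)

section iterates

variable {ρ α γ : ℝ} {prev θ θ₀ : Fin 2 → ℝ}

theorem Trapped.isNearSGA (h : Trapped ρ α prev θ) (hα : SmallRate ρ α) (hγ : SmallRate ρ γ)
    (F : Algorithm (Fin 2)) : IsNearSGA θ (F.direction gameN α γ prev θ) :=
  isNearSGA_direction hα hγ (hα.norm_le_of_mem_disc h.mem_disc)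
    (hα.norm_le_of_mem_disc h.prev_mem_disc) h.norm_sub_le F

theorem Trapped.step (h : Trapped ρ α prev θ) (hα : SmallRate ρ α) (hγ : SmallRate ρ γ)
    (F : Algorithm (Fin 2)) : Trapped ρ α θ (θ - α • F.direction gameN α γ prev θ) :=
  have hd := h.isNearSGA hα hγ F
  ⟨h.mem_disc, hα.step_mem_disc hd h.mem_disc, hα.dotProduct_self_step_pos hd h.mem_disc h.pos,
    hα.norm_step_sub_le hd h.mem_disc⟩

theorem trapped_self (hα : SmallRate ρ α) (hθ : θ ⬝ᵥ θ ≤ ρ ^ 2) (hpos : 0 < θ ⬝ᵥ θ) :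
    Trapped ρ α θ θ :=
  ⟨hθ, hθ, hpos, by
    rw [sub_self, norm_zero]
    exact mul_nonneg hα.pos.le (by positivity)⟩

theorem trapped_iterates (hα : SmallRate ρ α) (hγ : SmallRate ρ γ) (hθ₀ : θ₀ ⬝ᵥ θ₀ ≤ ρ ^ 2)
    (hpos : 0 < θ₀ ⬝ᵥ θ₀) (F : Algorithm (Fin 2)) (k : ℕ) :
    Trapped ρ α (F.iterates gameN α γ θ₀ (k - 1)) (F.iterates gameN α γ θ₀ k) := by
  induction k with
  | zero => exact trapped_self hα hθ₀ hpos
  | succ k ih =>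
    rw [F.iterates_succ, Nat.add_sub_cancel]
    exact ih.step hα hγ F

theorem isCritical_of_tendsto {z d : ℕ → Fin 2 → ℝ} {c : Fin 2 → ℝ}
    (hd : ∀ k, IsNearSGA (z k) (d k)) (hz : Tendsto z atTop (𝓝 c))
    (hd_zero : Tendsto d atTop (𝓝 0)) : gameN.IsCritical c := by
  have hxi : Tendsto (fun k => gameN.xi (z k)) atTop (𝓝 (gameN.xi c)) :=
    (continuous_xi.tendsto c).comp hz
  have hle : gameN.xi c ⬝ᵥ gameN.xi c ≤ 4 * ((0 : Fin 2 → ℝ) ⬝ᵥ 0) :=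
    le_of_tendsto_of_tendsto'
      ((continuous_dotProduct_self.tendsto _).comp hxi)
      (((continuous_dotProduct_self.tendsto _).comp hd_zero).const_mul 4)
      fun k => (hd k).xi_dotProduct_self_le
  rw [zero_dotProduct, mul_zero] at hle
  exact dotProduct_self_eq_zero.1 (hle.antisymm (dotProduct_self_nonneg _))

theorem not_tendsto_iterates (hα : SmallRate ρ α) (hγ : SmallRate ρ γ) (hθ₀ : θ₀ ⬝ᵥ θ₀ ≤ ρ ^ 2)
    (hpos : 0 < θ₀ ⬝ᵥ θ₀) (F : Algorithm (Fin 2)) (c : Fin 2 → ℝ) :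
    ¬ Tendsto (F.iterates gameN α γ θ₀) atTop (𝓝 c) := by
  intro hc
  have htrap := trapped_iterates hα hγ hθ₀ hpos F
  have hdir k := (htrap k).isNearSGA hα hγ F
  obtain rfl : c = 0 := eq_zero_of_isCritical <| isCritical_of_tendsto hdir hc <|
    tendsto_zero_of_tendsto_of_sub_smul hα.pos.ne' (F.iterates_succ gameN α γ θ₀) hc
  have hzero : Tendsto (fun k => F.iterates gameN α γ θ₀ k ⬝ᵥ F.iterates gameN α γ θ₀ k) atTop
      (𝓝 0) := by
    simpa only [Function.comp_def, zero_dotProduct] using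
      (continuous_dotProduct_self.tendsto 0).comp hc
  refine not_tendsto_zero_of_le_succ (ε := 1 / 3) (by norm_num) (fun k => (htrap k).pos)
    (fun k hk => ?_) hzero
  rw [F.iterates_succ]
  exact hα.dotProduct_self_le_step (hdir k) hk

theorem isBounded_range_iterates (hα : SmallRate ρ α) (hγ : SmallRate ρ γ)
    (hθ₀ : θ₀ ⬝ᵥ θ₀ ≤ ρ ^ 2) (hpos : 0 < θ₀ ⬝ᵥ θ₀) (F : Algorithm (Fin 2)) :
    Bornology.IsBounded (Set.range (F.iterates gameN α γ θ₀)) :=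
  isBounded_iff_forall_norm_le.2 ⟨ρ, Set.forall_mem_range.2 fun k =>
    hα.norm_le_of_mem_disc (trapped_iterates hα hγ hθ₀ hpos F k).mem_disc⟩

end iterates

theorem exists_smallRate_of_isBounded {U : Set (Fin 2 → ℝ)} (hU : Bornology.IsBounded U) :
    ∃ ρ δ : ℝ, 0 < δ ∧ (∀ β, 0 < β → β < δ → SmallRate ρ β) ∧ ∀ θ ∈ U, θ ⬝ᵥ θ ≤ ρ ^ 2 := by
  obtain ⟨s, hs, hUs⟩ := hU.subset_closedBall_lt 4 0
  have hρ : 0 < (2 * s) ^ 6 := by positivity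
  refine ⟨2 * s, 1 / 64 / (2 * s) ^ 6, by positivity, fun β hβ hβδ =>
    ⟨by linarith, hβ, ((lt_div_iff₀ hρ).1 hβδ).le⟩, fun θ hθ => ?_⟩
  have hnorm : ‖θ‖ ≤ s := mem_closedBall_zero_iff.1 (hUs hθ)
  calc θ ⬝ᵥ θ ≤ 2 * ‖θ‖ ^ 2 := by
        simpa only [Fintype.card_fin, Nat.cast_ofNat] using dotProduct_self_le_card_mul_sq_norm θ
    _ ≤ 2 * s ^ 2 := by gcongr
    _ ≤ (2 * s) ^ 2 := by nlinarith

end gameN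

theorem theorem3_general :
    (gameN.ZeroSum ∧ gameN.WeaklyCoercive ∧ gameN.Nondegenerate ∧ gameN.Analytic) ∧
    ∃ c : Fin 2 → ℝ, gameN.IsStrictMax c ∧ (∀ θ, gameN.IsCritical θ → θ = c) ∧
    ∀ U : Set (Fin 2 → ℝ), Bornology.IsBounded U →
      ∃ δ : ℝ, 0 < δ ∧ ∀ α γ : ℝ, 0 < α → α < δ → 0 < γ → γ < δ →
        ∀ F : Algorithm (Fin 2), ∀ θ₀ ∈ U, θ₀ ≠ c →
          (∀ k, F.StepDefined gameN α (F.iterates gameN α γ θ₀ k)) ∧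
          Bornology.IsBounded (Set.range (F.iterates gameN α γ θ₀)) ∧
          ¬ ∃ l, Tendsto (F.iterates gameN α γ θ₀) atTop (𝓝 l) := by
  refine ⟨⟨gameN.zeroSum, gameN.weaklyCoercive, gameN.nondegenerate, gameN.analytic⟩, 0,
    gameN.isStrictMax_zero, fun θ => gameN.eq_zero_of_isCritical, fun U hU => ?_⟩
  obtain ⟨ρ, δ, hδ, hsmall, hUρ⟩ := gameN.exists_smallRate_of_isBounded hU
  refine ⟨δ, hδ, fun α γ hα hαδ hγ hγδ F θ₀ hθ₀ hne => ?_⟩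
  have hα := hsmall α hα hαδ
  have hγ := hsmall γ hγ hγδ
  have hpos : 0 < θ₀ ⬝ᵥ θ₀ :=
    (dotProduct_self_nonneg θ₀).lt_of_ne' (dotProduct_self_eq_zero.not.2 hne)
  have htrap := gameN.trapped_iterates hα hγ (hUρ θ₀ hθ₀) hpos F
  exact ⟨fun k => gameN.stepDefined hα (hα.norm_le_of_mem_disc (htrap k).mem_disc) F,
    gameN.isBounded_range_iterates hα hγ (hUρ θ₀ hθ₀) hpos F,
    not_exists.2 (gameN.not_tendsto_iterates hα hγ (hUρ θ₀ hθ₀) hpos F)⟩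

theorem theorem3 :
    (gameN.ZeroSum ∧ gameN.WeaklyCoercive ∧ gameN.Nondegenerate ∧ gameN.Analytic) ∧
    (∃ c : Fin 2 → ℝ, gameN.IsStrictMax c ∧ ∀ θ, gameN.IsCritical θ → θ = c) ∧
    ∀ U : Set (Fin 2 → ℝ), Bornology.IsBounded U →
      ∃ δ : ℝ, 0 < δ ∧ ∀ α γ : ℝ, 0 < α → α < δ → 0 < γ → γ < δ →
        ∀ F : Algorithm (Fin 2),
          ∀ ν : Measure (Fin 2 → ℝ), IsProbabilityMeasure ν → (∀ θ, ν {θ} = 0) → ν Uᶜ = 0 →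
            ∀ᵐ θ₀ ∂ν,
              (∀ k, F.StepDefined gameN α (F.iterates gameN α γ θ₀ k)) ∧
              Bornology.IsBounded (Set.range (F.iterates gameN α γ θ₀)) ∧
              ¬ ∃ l, Tendsto (F.iterates gameN α γ θ₀) atTop (𝓝 l) := by
  obtain ⟨hgame, c, hmax, huniq, hcycle⟩ := theorem3_general
  refine ⟨hgame, ⟨c, hmax, huniq⟩, fun U hU => (hcycle U hU).imp fun δ ⟨hδ, h⟩ =>
    ⟨hδ, fun α γ hα hαδ hγ hγδ F ν _ hν hνU => ?_⟩⟩
  filter_upwards [measure_eq_zero_iff_ae_notMem.1 (hν c), mem_ae_iff.2 hνU] with θ₀ hne hθ₀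
  exact h α γ hα hαδ hγ hγδ F θ₀ hθ₀ hne
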